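/- Let $\mathsf d\ge 1$ be an integer and let $r,s\in\mathbb{R}$ with $0\le r<s$ be fixed. For a finite set $\Gamma\subset\mathbb{Z}^{\mathsf d}$ define its Lebesgue constant by $$\mathcal{L}(\Gamma)=\frac{1}{(2\pi)^{\mathsf d}}\int_{[-\pi,\pi)^{\mathsf d}}\Bigl|\sum_{\gamma\in\Gamma}e^{\mathbf{i}(\gamma,t)}\Bigr|\,dt,\qquad (\gamma,t)=\sum_{i=1}^{\mathsf d}\gamma_i t_i ,$$ and for $m=(m_1,\dots,m_{\mathsf d})$ with positive integers $m_1,\dots,m_{\mathsf d}$ let $$\Xi^{(m)}_{(r,s)}=\Bigl\{\gamma\in\mathbb{Z}^{\mathsf d}\ :\ r\le \frac{\gamma_{\mathsf d}}{m_{\mathsf d}}\le\cdots\le\frac{\gamma_2}{m_2}\le\frac{\gamma_1}{m_1}\le s\Bigr\}.$$ Then there is a constant $C>0$, depending only on $\mathsf d$, $r$ and $s$, such that for all $m_1,\dots,m_{\mathsf d}\in\{1,2,3,\dots\}$ $$\mathcal{L}\bigl(\Xi^{(m)}_{(r,s)}\bigr)\le C\prod_{i=1}^{\mathsf d}\ln(m_i+1).$$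 -/

import Mathlib

/-- The partial Fourier kernel `t ↦ ∑_{γ ∈ Γ} e^{i (γ, t)}` of a finite set `Γ ⊂ ℤ^d`, where
`(γ, t) = ∑ i, γ i * t i`. -/
noncomputable def fourierKernel {d : ℕ} (Γ : Finset (Fin d → ℤ)) (t : Fin d → ℝ) : ℂ :=
  ∑ γ ∈ Γ, Complex.exp (Complex.I * ((∑ i, (γ i : ℝ) * t i : ℝ) : ℂ))

/-- The Lebesgue constant of a finite set `Γ ⊂ ℤ^d`: the normalized `L¹([-π, π)^d)`-norm of its
partial Fourier kernel. -/
noncomputable def lebesgueConstant {d : ℕ} (Γ : Finset (Fin d → ℤ)) : ℝ :=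
  1 / (2 * Real.pi) ^ d *
    ∫ t in Set.univ.pi (fun _ : Fin d => Set.Ico (-Real.pi) Real.pi), ‖fourierKernel Γ t‖

/-- The set of all `γ ∈ ℤ^d` with `r ≤ γ_d / m_d ≤ ⋯ ≤ γ_2 / m_2 ≤ γ_1 / m_1 ≤ s`. -/
def polyhedralSet {d : ℕ} (r s : ℝ) (m : Fin d → ℕ) : Set (Fin d → ℤ) :=
  {γ | (∀ i, r ≤ (γ i : ℝ) / (m i : ℝ)) ∧
    (∀ i j, i ≤ j → (γ j : ℝ) / (m j : ℝ) ≤ (γ i : ℝ) / (m i : ℝ)) ∧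
    (∀ i, (γ i : ℝ) / (m i : ℝ) ≤ s)}

theorem polyhedralSet_finite {d : ℕ} (r s : ℝ) {m : Fin d → ℕ} (hm : ∀ i, 0 < m i) :
    (polyhedralSet r s m).Finite := by
  refine (Set.Finite.pi' (fun i => Set.finite_Icc ⌈r * m i⌉ ⌊s * m i⌋)).subset ?_
  rintro γ ⟨h1, -, h2⟩ i
  have hp : (0 : ℝ) < m i := by exact_mod_cast hm i
  exact ⟨Int.ceil_le.2 ((le_div_iff₀ hp).1 (h1 i)), Int.le_floor.2 ((div_le_iff₀ hp).1 (h2 i))⟩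

/-- The same set as a `Finset`, for positive `m_1, …, m_d`. -/
noncomputable def polyhedralFinset {d : ℕ} (r s : ℝ) (m : Fin d → ℕ) (hm : ∀ i, 0 < m i) :
    Finset (Fin d → ℤ) :=
  (polyhedralSet_finite r s hm).toFinset

/-! Induction on the dimension, eliminating the coordinate `j` with the largest `m j`. With the
other coordinates fixed, `γ j` runs through an interval of integers whose ends are the rounded
values of `m j` times the neighbouring quotients (or times `s`, `r` at the ends of the chain).
Multiplying the kernel by `e^{ix} - 1`, where `x` is the variable dual to `γ j`, telescopes the
geometric sum (`exp_sub_one_mul_trigPoly`). What remains is the lower-dimensional kernel with its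
coefficients multiplied by a difference of two functions, each depending on at most one coordinate
`n`: phases such as `e^{i(⌊pn/q⌋+1)x}` and `e^{i⌈pn/q⌉x}`, with `p = m j` and `q ≤ p`.

Each phase minus 1 is an `L¹`-multiplier of norm `O(|x| (log (p+1) + p/(1+p|x|)))`. To see this,
write `⌊pn/q⌋ = pn/q - (np mod q)/q`. The residue phase is a combination of characters of `ℤ/q`, and
the deviation of its coefficients from the constant 1 has `ℓ¹` norm `O(|x| log (q+1))`
(`isMult_exp_emod_sub_one`). The linear phase minus 1 trivially has norm at most 2. For small `p|x|`
it is expanded as a power series in `n/q`, itself a bounded multiplier on the bounded range of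
quotients because it agrees there with a function having an absolutely convergent Fourier series
(`isMult_linear`).

Dividing by `|e^{ix} - 1| ≥ 2|x|/π` cancels `|x|`, and integrating over `x` costs one factor `O(log
(p+1))`. The maximality of `m j` is what lets `log q` be absorbed into this factor. -/

open MeasureTheory Set

/-! ### `L¹` norms of trigonometric polynomials. -/

/-- The trigonometric polynomial `t ↦ ∑_{γ ∈ Γ} c γ e^{i (γ, t)}`. -/
noncomputable def trigPoly {d : ℕ} (Γ : Finset (Fin d → ℤ)) (c : (Fin d → ℤ) → ℂ)
    (t : Fin d → ℝ) : ℂ :=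
  ∑ γ ∈ Γ, c γ * Complex.exp (Complex.I * ((∑ i, (γ i : ℝ) * t i : ℝ) : ℂ))

/-- Lebesgue measure on `[-π, π)`. -/
noncomputable def circleMeasure : Measure ℝ := volume.restrict (Ico (-Real.pi) Real.pi)

instance : IsFiniteMeasure circleMeasure := by
  unfold circleMeasure; infer_instance

/-- Lebesgue measure on `[-π, π)^d`. -/
noncomputable def boxMeasure (d : ℕ) : Measure (Fin d → ℝ) := Measure.pi fun _ => circleMeasure

instance (d : ℕ) : IsFiniteMeasure (boxMeasure d) := by
  unfold boxMeasure; infer_instance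

/-- The (unnormalized) `L¹`-norm of a trigonometric polynomial. -/
noncomputable def trigNorm {d : ℕ} (Γ : Finset (Fin d → ℤ)) (c : (Fin d → ℤ) → ℂ) : ℝ :=
  ∫ t, ‖trigPoly Γ c t‖ ∂boxMeasure d

theorem continuous_trigPoly {d : ℕ} (Γ : Finset (Fin d → ℤ)) (c : (Fin d → ℤ) → ℂ) :
    Continuous (trigPoly Γ c) := by
  unfold trigPoly; fun_prop

theorem norm_trigPoly_le {d : ℕ} (Γ : Finset (Fin d → ℤ)) (c : (Fin d → ℤ) → ℂ)
    (t : Fin d → ℝ) : ‖trigPoly Γ c t‖ ≤ ∑ γ ∈ Γ, ‖c γ‖ := by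
  refine (norm_sum_le _ _).trans (Finset.sum_le_sum fun γ _ => ?_)
  rw [norm_mul, Complex.norm_exp_I_mul_ofReal, mul_one]

theorem integrable_norm_trigPoly {d : ℕ} (Γ : Finset (Fin d → ℤ)) (c : (Fin d → ℤ) → ℂ) :
    Integrable (fun t => ‖trigPoly Γ c t‖) (boxMeasure d) :=
  (Integrable.of_bound (continuous_trigPoly Γ c).aestronglyMeasurable _
    (Filter.Eventually.of_forall (norm_trigPoly_le Γ c))).norm

theorem lebesgueConstant_eq {d : ℕ} (Γ : Finset (Fin d → ℤ)) :
    lebesgueConstant Γ = 1 / (2 * Real.pi) ^ d * trigNorm Γ fun _ => 1 := by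
  unfold lebesgueConstant trigNorm boxMeasure circleMeasure
  rw [← Measure.restrict_pi_pi, ← volume_pi]
  simp only [trigPoly, fourierKernel, one_mul]

theorem trigNorm_nonneg {d : ℕ} (Γ : Finset (Fin d → ℤ)) (c : (Fin d → ℤ) → ℂ) :
    0 ≤ trigNorm Γ c := integral_nonneg fun _ => norm_nonneg _

theorem trigPoly_add {d : ℕ} (Γ : Finset (Fin d → ℤ)) (c c' : (Fin d → ℤ) → ℂ) (t : Fin d → ℝ) :
    trigPoly Γ (fun γ => c γ + c' γ) t = trigPoly Γ c t + trigPoly Γ c' t := by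
  simp only [trigPoly, add_mul, Finset.sum_add_distrib]

theorem trigNorm_add_le {d : ℕ} (Γ : Finset (Fin d → ℤ)) (c c' : (Fin d → ℤ) → ℂ) :
    trigNorm Γ (fun γ => c γ + c' γ) ≤ trigNorm Γ c + trigNorm Γ c' := by
  unfold trigNorm
  rw [← integral_add (integrable_norm_trigPoly _ _) (integrable_norm_trigPoly _ _)]
  refine integral_mono (integrable_norm_trigPoly _ _)
    ((integrable_norm_trigPoly _ _).add (integrable_norm_trigPoly _ _)) fun t => ?_
  simp only [trigPoly_add]
  exact norm_add_le _ _

theorem trigNorm_smul {d : ℕ} (Γ : Finset (Fin d → ℤ)) (c : (Fin d → ℤ) → ℂ) (z : ℂ) :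
    trigNorm Γ (fun γ => z * c γ) = ‖z‖ * trigNorm Γ c := by
  unfold trigNorm
  rw [← integral_const_mul]
  simp only [trigPoly, mul_assoc, ← Finset.mul_sum, norm_mul]

theorem trigNorm_congr {d : ℕ} {Γ : Finset (Fin d → ℤ)} {c c' : (Fin d → ℤ) → ℂ}
    (h : ∀ γ ∈ Γ, c γ = c' γ) : trigNorm Γ c = trigNorm Γ c' := by
  unfold trigNorm trigPoly
  refine integral_congr_ae (Filter.Eventually.of_forall fun t => ?_)
  dsimp only
  rw [Finset.sum_congr rfl fun γ hγ => by rw [h γ hγ]]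

theorem trigNorm_le {d : ℕ} (Γ : Finset (Fin d → ℤ)) (c : (Fin d → ℤ) → ℂ) :
    trigNorm Γ c ≤ (∑ γ ∈ Γ, ‖c γ‖) * (boxMeasure d).real univ := by
  unfold trigNorm
  refine (integral_mono (integrable_norm_trigPoly _ _) (integrable_const _)
    (norm_trigPoly_le Γ c)).trans ?_
  rw [integral_const, smul_eq_mul, mul_comm]

theorem integral_circleMeasure_add {f : ℝ → ℝ} (hf : Function.Periodic f (2 * Real.pi)) (α : ℝ) :
    ∫ x, f (x + α) ∂circleMeasure = ∫ x, f x ∂circleMeasure := by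
  have hpi : -Real.pi ≤ Real.pi := by linarith [Real.pi_pos]
  unfold circleMeasure
  rw [integral_Ico_eq_integral_Ioc, integral_Ico_eq_integral_Ioc,
    ← intervalIntegral.integral_of_le hpi, ← intervalIntegral.integral_of_le hpi,
    intervalIntegral.integral_comp_add_right]
  have := hf.intervalIntegral_add_eq (-Real.pi + α) (-Real.pi)
  convert this using 2 <;> ring

/-- Fubini in both orders: integrating over `x` first serves translation invariance, integrating
over `x` last serves the elimination of a coordinate. -/
theorem integral_boxMeasure_succ {d : ℕ} (j : Fin (d + 1)) {f : (Fin (d + 1) → ℝ) → ℝ}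
    (hf : Integrable f (boxMeasure (d + 1))) :
    (∫ t, f t ∂boxMeasure (d + 1) =
      ∫ x, ∫ t, f (Fin.insertNth j x t) ∂boxMeasure d ∂circleMeasure) ∧
    Integrable (fun x => ∫ t, f (Fin.insertNth j x t) ∂boxMeasure d) circleMeasure ∧
    Integrable (fun t => ∫ x, f (Fin.insertNth j x t) ∂circleMeasure) (boxMeasure d) ∧
    (∫ t, f t ∂boxMeasure (d + 1) =
      ∫ t, ∫ x, f (Fin.insertNth j x t) ∂circleMeasure ∂boxMeasure d) := by
  have hmp := (measurePreserving_piFinSuccAbove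
    (fun _ : Fin (d + 1) => circleMeasure) j).symm
  have hint : Integrable (fun z : ℝ × (Fin d → ℝ) => f (Fin.insertNth j z.1 z.2))
      (circleMeasure.prod (boxMeasure d)) :=
    (hmp.integrable_comp_emb (MeasurableEquiv.measurableEmbedding _)).2 hf
  have heq : ∫ t, f t ∂boxMeasure (d + 1) =
      ∫ z, f (Fin.insertNth j z.1 z.2) ∂(circleMeasure.prod (boxMeasure d)) :=
    (hmp.integral_comp' f).symm
  refine ⟨?_, hint.integral_prod_left, hint.integral_prod_right, ?_⟩
  · rw [heq, integral_prod _ hint]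
  · rw [heq, integral_prod_symm _ hint]

theorem trigPoly_insertNth_add {d : ℕ} (Γ : Finset (Fin (d + 1) → ℤ))
    (c : (Fin (d + 1) → ℤ) → ℂ) (j : Fin (d + 1)) (x α : ℝ) (t : Fin d → ℝ) :
    trigPoly Γ c (Fin.insertNth j (x + α) t) =
      trigPoly Γ (fun γ => c γ * Complex.exp (Complex.I * ((α * γ j : ℝ) : ℂ)))
        (Fin.insertNth j x t) := by
  unfold trigPoly
  refine Finset.sum_congr rfl fun γ _ => ?_
  rw [mul_assoc, ← Complex.exp_add, Fin.sum_univ_succAbove _ j, Fin.sum_univ_succAbove _ j]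
  simp only [Fin.insertNth_apply_same, Fin.insertNth_apply_succAbove]
  congr 2
  push_cast
  ring

/-- Modulating the coefficients by `e^{iαγ_j}` translates the polynomial by `α` in the variable
`t_j`, in which it is `2π`-periodic because frequencies are integers. -/
theorem trigNorm_mul_exp {d : ℕ} (Γ : Finset (Fin d → ℤ)) (c : (Fin d → ℤ) → ℂ) (j : Fin d)
    (α : ℝ) :
    trigNorm Γ (fun γ => c γ * Complex.exp (Complex.I * ((α * γ j : ℝ) : ℂ))) = trigNorm Γ c := by
  cases d with
  | zero => exact j.elim0
  | succ d =>
    unfold trigNorm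
    rw [(integral_boxMeasure_succ j (integrable_norm_trigPoly _ _)).2.2.2,
      (integral_boxMeasure_succ j (integrable_norm_trigPoly _ _)).2.2.2]
    refine integral_congr_ae (Filter.Eventually.of_forall fun t => ?_)
    simp only [← trigPoly_insertNth_add]
    refine integral_circleMeasure_add (f := fun x => ‖trigPoly Γ c (Fin.insertNth j x t)‖)
      (fun x => ?_) α
    dsimp only
    rw [trigPoly_insertNth_add]
    congr 2
    funext γ
    have : Complex.I * ((2 * Real.pi * γ j : ℝ) : ℂ) = (γ j : ℂ) * (2 * Real.pi * Complex.I) := by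
      push_cast; ring
    rw [this, Complex.exp_int_mul_two_pi_mul_I, mul_one]

/-! ### Calculus of one-coordinate multipliers. -/

/-- `f` is an `L¹`-multiplier of norm at most `A` in each single coordinate, on trigonometric
polynomials whose frequencies in that coordinate lie in `S`. -/
def IsMult (S : Set ℤ) (f : ℤ → ℂ) (A : ℝ) : Prop :=
  ∀ (d : ℕ) (Γ : Finset (Fin d → ℤ)) (j : Fin d) (c : (Fin d → ℤ) → ℂ), (∀ γ ∈ Γ, γ j ∈ S) →
    trigNorm Γ (fun γ => c γ * f (γ j)) ≤ A * trigNorm Γ c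

namespace IsMult

variable {S : Set ℤ} {f g : ℤ → ℂ} {A B : ℝ}

theorem mono (h : IsMult S f A) (hAB : A ≤ B) : IsMult S f B := fun d Γ j c hΓ =>
  (h d Γ j c hΓ).trans (mul_le_mul_of_nonneg_right hAB (trigNorm_nonneg _ _))

theorem congr (h : IsMult S f A) (hfg : ∀ n ∈ S, g n = f n) : IsMult S g A :=
  fun d Γ j c hΓ => by
    rw [trigNorm_congr (c' := fun γ => c γ * f (γ j)) fun γ hγ => by rw [hfg _ (hΓ γ hγ)]]
    exact h d Γ j c hΓ

theorem exp (S : Set ℤ) (α : ℝ) :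
    IsMult S (fun n => Complex.exp (Complex.I * ((α * n : ℝ) : ℂ))) 1 := fun d Γ j c _ => by
  rw [trigNorm_mul_exp, one_mul]

theorem const_mul (h : IsMult S f A) (z : ℂ) : IsMult S (fun n => z * f n) (‖z‖ * A) :=
  fun d Γ j c hΓ => by
    have h1 := h d Γ j c hΓ
    have h2 := trigNorm_smul Γ (fun γ => c γ * f (γ j)) z
    simp only [mul_left_comm _ z, h2, mul_assoc]
    exact mul_le_mul_of_nonneg_left h1 (norm_nonneg _)

theorem const (S : Set ℤ) (z : ℂ) : IsMult S (fun _ => z) ‖z‖ := by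
  simpa using (exp S 0).const_mul z

theorem add (hf : IsMult S f A) (hg : IsMult S g B) : IsMult S (fun n => f n + g n) (A + B) :=
  fun d Γ j c hΓ => by
    simp only [mul_add, add_mul]
    exact (trigNorm_add_le Γ _ _).trans (add_le_add (hf d Γ j c hΓ) (hg d Γ j c hΓ))

theorem mul (hf : IsMult S f A) (hg : IsMult S g B) (hA : 0 ≤ A) :
    IsMult S (fun n => f n * g n) (A * B) := fun d Γ j c hΓ => by
  have h1 := hf d Γ j (fun γ => c γ * g (γ j)) hΓ
  rw [trigNorm_congr (c' := fun γ => c γ * g (γ j) * f (γ j)) fun γ _ => by ring, mul_assoc]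
  exact h1.trans (mul_le_mul_of_nonneg_left (hg d Γ j c hΓ) hA)

theorem pow (hf : IsMult S f A) (hA : 0 ≤ A) (k : ℕ) : IsMult S (fun n => f n ^ k) (A ^ k) := by
  induction k with
  | zero => simpa using const S 1
  | succ k ih => simpa only [pow_succ] using ih.mul hf (pow_nonneg hA k)

theorem sum {ι : Type*} (s : Finset ι) {f : ι → ℤ → ℂ} {A : ι → ℝ}
    (h : ∀ k ∈ s, IsMult S (f k) (A k)) :
    IsMult S (fun n => ∑ k ∈ s, f k n) (∑ k ∈ s, A k) := by
  classical
  induction s using Finset.induction_on with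
  | empty => simpa using const S 0
  | insert a s ha ih =>
    simp only [Finset.sum_insert ha]
    exact (h a (Finset.mem_insert_self a s)).add (ih fun k hk => h k (Finset.mem_insert_of_mem hk))

/-- Only finitely many frequencies occur in `Γ`, so pointwise convergence on `S` already makes the
`L¹` error tend to zero. -/
theorem of_tendsto {F : ℕ → ℤ → ℂ} {A : ℕ → ℝ} {f : ℤ → ℂ} {a : ℝ}
    (hF : ∀ k, IsMult S (F k) (A k))
    (hf : ∀ n ∈ S, Filter.Tendsto (fun k => F k n) Filter.atTop (nhds (f n)))
    (hA : Filter.Tendsto A Filter.atTop (nhds a)) : IsMult S f a := fun d Γ j c hΓ => by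
  have key : ∀ k, trigNorm Γ (fun γ => c γ * f (γ j)) ≤
      (∑ γ ∈ Γ, ‖c γ * (f (γ j) - F k (γ j))‖) * (boxMeasure d).real univ +
        A k * trigNorm Γ c := fun k => by
    refine le_trans ?_ (add_le_add (trigNorm_le Γ fun γ => c γ * (f (γ j) - F k (γ j)))
      (hF k d Γ j c hΓ))
    refine le_trans (le_of_eq (trigNorm_congr fun γ _ => ?_)) (trigNorm_add_le Γ _ _)
    ring
  have lim : Filter.Tendsto (fun k => (∑ γ ∈ Γ, ‖c γ * (f (γ j) - F k (γ j))‖) *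
      (boxMeasure d).real univ + A k * trigNorm Γ c) Filter.atTop
      (nhds ((∑ γ ∈ Γ, ‖c γ * (f (γ j) - f (γ j))‖) * (boxMeasure d).real univ +
        a * trigNorm Γ c)) := by
    refine Filter.Tendsto.add (Filter.Tendsto.mul_const _ (tendsto_finsetSum _ fun γ hγ => ?_))
      (hA.mul_const _)
    exact ((tendsto_const_nhds.sub (hf _ (hΓ γ hγ))).const_mul (c γ)).norm
  simpa using ge_of_tendsto' lim key

theorem hasSum {F : ℕ → ℤ → ℂ} {A : ℕ → ℝ} {f : ℤ → ℂ} {a : ℝ}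
    (hF : ∀ k, IsMult S (F k) (A k)) (hf : ∀ n ∈ S, HasSum (fun k => F k n) (f n))
    (hA : HasSum A a) : IsMult S f a :=
  of_tendsto (F := fun N n => ∑ k ∈ Finset.range N, F k n) (fun _ => sum _ fun k _ => hF k)
    (fun n hn => (hf n hn).tendsto_sum_nat) hA.tendsto_sum_nat

end IsMult

/-! ### Linear phases on a bounded range. -/

/-- The quadratic Bernoulli polynomial along an arithmetic progression in `[0, 1]` is a
multiplier, with norm independent of the progression. -/
theorem isMult_bernoulliFun_two {S : Set ℤ} {α β : ℝ} (h : ∀ n ∈ S, α * n + β ∈ Icc (0 : ℝ) 1) :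
    IsMult S (fun n => ((bernoulliFun 2 (α * n + β) : ℝ) : ℂ)) (1 / 6) := by
  have hpi : (Real.pi : ℂ) ≠ 0 := by exact_mod_cast Real.pi_ne_zero
  -- The Fourier series of `B₂`; its `k = 0` term vanishes because `1 / 0 = 0`. The term norms
  -- `1/(π²k²)` add up to `1/6`.
  refine IsMult.hasSum (F := fun k n => (1 / (2 * Real.pi ^ 2) : ℂ) * ((1 : ℂ) / (k : ℂ) ^ 2 *
      (fourier k (((α * n + β : ℝ)) : UnitAddCircle) +
        (-1 : ℂ) ^ 2 * fourier (-k) (((α * n + β : ℝ)) : UnitAddCircle))))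
    (A := fun k => 1 / Real.pi ^ 2 * ((1 : ℝ) / (k : ℝ) ^ 2)) (fun k => ?_) (fun n hn => ?_) ?_
  · have e : ∀ k : ℤ, IsMult S (fun n => fourier k (((α * n + β : ℝ)) : UnitAddCircle)) 1 := by
      intro k
      have := (IsMult.exp S (2 * Real.pi * k * α)).const_mul
        (Complex.exp (Complex.I * ((2 * Real.pi * k * β : ℝ) : ℂ)))
      rw [Complex.norm_exp_I_mul_ofReal, one_mul] at this
      refine this.congr fun n _ => ?_
      rw [fourier_coe_apply, ← Complex.exp_add]
      congr 1
      push_cast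
      ring
    refine ((((e k).add ((e (-k)).const_mul ((-1) ^ 2))).const_mul _).const_mul _).mono
      (le_of_eq ?_)
    simp only [norm_div, norm_pow, norm_neg, norm_one, norm_mul, Complex.norm_ofNat,
      Complex.norm_real, Real.norm_eq_abs, abs_of_pos Real.pi_pos, Complex.norm_natCast]
    ring
  · have := (hasSum_one_div_nat_pow_mul_fourier le_rfl (h n hn)).mul_left
      (1 / (2 * Real.pi ^ 2) : ℂ)
    convert! this using 1
    simp only [mul_pow, Complex.I_sq, Nat.factorial]
    push_cast
    field_simp
  · have := hasSum_zeta_two.mul_left (1 / Real.pi ^ 2)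
    convert! this using 1
    field_simp

theorem isMult_linear {S : Set ℤ} {α : ℝ} (h : ∀ n ∈ S, α * n ∈ Icc (0 : ℝ) (1 / 2)) :
    IsMult S (fun n => ((α * n : ℝ) : ℂ)) 1 := by
  have h1 := isMult_bernoulliFun_two (β := 1 / 2) (α := α) (S := S) fun n hn => by
    constructor <;> linarith [(h n hn).1, (h n hn).2]
  have h2 := isMult_bernoulliFun_two (β := 0) (α := α) (S := S) fun n hn => by
    constructor <;> linarith [(h n hn).1, (h n hn).2]
  -- `x = 1/4 + B₂(x + 1/2) - B₂(x)`, of total norm `1/4 + 1/6 + 1/6 ≤ 1`. The range `[0, 1/2]`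
  -- keeps both arguments in `[0, 1]`.
  refine (((IsMult.const S (1 / 4)).add h1).add (h2.const_mul (-1))).congr (fun n _ => ?_)
    |>.mono ?_
  · simp only [bernoulliFun_two]
    push_cast
    ring
  · norm_num

/-- Every power of `αn` has multiplier norm at most 1, so the exponential series without its
constant term is bounded by `e^{|τ|} - 1`. -/
theorem isMult_exp_linear_sub_one {S : Set ℤ} {α : ℝ} (h : ∀ n ∈ S, α * n ∈ Icc (0 : ℝ) (1 / 2))
    (τ : ℝ) :
    IsMult S (fun n => Complex.exp (Complex.I * ((τ * (α * n) : ℝ) : ℂ)) - 1)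
      (Real.exp |τ| - 1) := by
  refine IsMult.hasSum
    (F := fun k n => ((k + 1).factorial : ℂ)⁻¹ * (Complex.I * τ) ^ (k + 1) *
      ((α * n : ℝ) : ℂ) ^ (k + 1))
    (A := fun k => ((k + 1).factorial : ℝ)⁻¹ * |τ| ^ (k + 1)) (fun k => ?_) (fun n _ => ?_) ?_
  · refine (((isMult_linear h).pow zero_le_one (k + 1)).const_mul _).mono (le_of_eq ?_)
    simp
  · have := (hasSum_nat_add_iff' 1).2
      (NormedSpace.expSeries_div_hasSum_exp (Complex.I * ((τ * (α * n) : ℝ) : ℂ)))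
    rw [← Complex.exp_eq_exp_ℂ] at this
    convert! this using 1
    · funext k
      rw [div_eq_inv_mul, mul_assoc, ← mul_pow]
      congr 2
      push_cast
      ring
    · simp
  · have := (hasSum_nat_add_iff' 1).2 (NormedSpace.expSeries_div_hasSum_exp |τ|)
    rw [← Real.exp_eq_exp_ℝ] at this
    convert! this using 1
    · funext k
      field_simp
    · simp

/-! ### Residue phases and Fourier expansion on `ℤ / q`. -/

theorem sum_exp_two_pi_mul_div {q : ℕ} (a b : ℕ) (ha : a < q) (hb : b < q) :
    ∑ k ∈ Finset.range q, Complex.exp (Complex.I * ((2 * Real.pi * k * ((a : ℝ) - b) / q : ℝ) : ℂ)) =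
      if a = b then (q : ℂ) else 0 := by
  have hq : (q : ℂ) ≠ 0 := by exact_mod_cast (Nat.zero_lt_of_lt ha).ne'
  split_ifs with hab
  · simp [hab]
  set ζ := Complex.exp (2 * Real.pi * Complex.I * (((a : ℤ) - b : ℤ) : ℂ) / q) with hζ
  have hpow : ∀ k : ℕ,
      Complex.exp (Complex.I * ((2 * Real.pi * k * ((a : ℝ) - b) / q : ℝ) : ℂ)) = ζ ^ k := by
    intro k
    rw [hζ, ← Complex.exp_nat_mul]
    congr 1
    push_cast
    ring
  have hζq : ζ ^ q = 1 := by
    rw [hζ, ← Complex.exp_nat_mul, ← Complex.exp_int_mul_two_pi_mul_I ((a : ℤ) - b)]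
    congr 1
    field_simp
  have hζ1 : ζ ≠ 1 := by
    intro h
    obtain ⟨n, hn⟩ := Complex.exp_eq_one_iff.1 h
    have h2 : (((a : ℤ) - b : ℤ) : ℂ) = ((n * q : ℤ) : ℂ) := by
      have := Complex.two_pi_I_ne_zero
      field_simp at hn
      push_cast at hn ⊢
      rw [hn, mul_comm]
    have h3 : (a : ℤ) - b = n * q := by exact_mod_cast h2
    have h4 : (q : ℤ) ∣ (a : ℤ) - b := ⟨n, by rw [h3, mul_comm]⟩
    have := Int.eq_zero_of_abs_lt_dvd h4 (by rw [abs_lt]; omega)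
    omega
  simp only [hpow]
  have := mul_geom_sum ζ q
  rw [hζq, sub_self, mul_eq_zero] at this
  exact this.resolve_left (sub_ne_zero.2 hζ1)

/-- Discrete Fourier coefficients of `a ↦ e^{-i a t / q}` on `ℤ / q`. -/
noncomputable def expCoeff (q : ℕ) (t : ℝ) (k : ℕ) : ℂ :=
  (q : ℂ)⁻¹ * ∑ b ∈ Finset.range q,
    Complex.exp (Complex.I * ((-(b * ((t + 2 * Real.pi * k) / q)) : ℝ) : ℂ))

theorem sum_expCoeff_mul_exp {q : ℕ} (t : ℝ) (a : ℕ) (ha : a < q) :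
    ∑ k ∈ Finset.range q, expCoeff q t k * Complex.exp
      (Complex.I * ((2 * Real.pi * k * a / q : ℝ) : ℂ)) =
      Complex.exp (Complex.I * ((-(a * (t / q)) : ℝ) : ℂ)) := by
  have hq : (q : ℂ) ≠ 0 := by exact_mod_cast (Nat.zero_lt_of_lt ha).ne'
  calc _ = (q : ℂ)⁻¹ * ∑ b ∈ Finset.range q,
        Complex.exp (Complex.I * ((-(b * (t / q)) : ℝ) : ℂ)) * ∑ k ∈ Finset.range q,
          Complex.exp (Complex.I * ((2 * Real.pi * k * ((a : ℝ) - b) / q : ℝ) : ℂ)) := by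
        simp only [expCoeff, Finset.mul_sum, Finset.sum_mul]
        rw [Finset.sum_comm]
        refine Finset.sum_congr rfl fun b _ => Finset.sum_congr rfl fun k _ => ?_
        rw [mul_assoc, ← Complex.exp_add, ← Complex.exp_add]
        congr 2
        push_cast
        ring
    _ = (q : ℂ)⁻¹ * ∑ b ∈ Finset.range q,
        Complex.exp (Complex.I * ((-(b * (t / q)) : ℝ) : ℂ)) * if a = b then (q : ℂ) else 0 := by
        congr 1
        refine Finset.sum_congr rfl fun b hb => ?_
        rw [sum_exp_two_pi_mul_div a b ha (Finset.mem_range.1 hb)]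
    _ = _ := by
        simp only [mul_ite, mul_zero, Finset.sum_ite_eq, Finset.mem_range, ha, if_true]
        field_simp

theorem norm_expCoeff_zero_sub_one_le {q : ℕ} (hq : 0 < q) (t : ℝ) :
    ‖expCoeff q t 0 - 1‖ ≤ |t| := by
  have hq0 : (0 : ℝ) < q := by exact_mod_cast hq
  have hqc : (q : ℂ) ≠ 0 := by exact_mod_cast hq.ne'
  have : expCoeff q t 0 - 1 = (q : ℂ)⁻¹ * ∑ b ∈ Finset.range q,
      (Complex.exp (Complex.I * ((-(b * (t / q)) : ℝ) : ℂ)) - 1) := by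
    rw [Finset.sum_sub_distrib, mul_sub]
    simp [expCoeff, hqc]
  rw [this, norm_mul, norm_inv, Complex.norm_natCast, inv_mul_le_iff₀ hq0]
  refine (norm_sum_le_of_le (f := fun b : ℕ =>
    Complex.exp (Complex.I * ((-(b * (t / q)) : ℝ) : ℂ)) - 1) (n := fun _ => |t|) _
      fun b hb => ?_).trans (by simp)
  refine Real.norm_exp_I_mul_ofReal_sub_one_le.trans ?_
  have hb' : (b : ℝ) ≤ q := by exact_mod_cast (Finset.mem_range.1 hb).le
  rw [Real.norm_eq_abs, abs_neg, abs_mul, abs_div, abs_of_nonneg (Nat.cast_nonneg b),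
    abs_of_pos hq0, mul_div_assoc', div_le_iff₀ hq0, mul_comm]
  exact mul_le_mul_of_nonneg_left hb' (abs_nonneg t)

/-- The coefficient is a geometric sum with ratio `z = e^{-2iu}`, `u = (t + 2πk)/(2q)`, so its size
is `|e^{-it} - 1| / (2q sin u)`. The numerator is at most `|t|`, and this factor `|t|` is essential
later. -/
theorem norm_expCoeff_le {q k : ℕ} (hk : 0 < k) (hkq : k < q) {t : ℝ} (ht : |t| ≤ Real.pi) :
    ‖expCoeff q t k‖ ≤ |t| / 2 * (1 / k + 1 / (q - k)) := by
  have hpi := Real.pi_pos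
  obtain ⟨ht1, ht2⟩ := abs_le.1 ht
  have hq0 : (0 : ℝ) < q := by exact_mod_cast hk.trans hkq
  have hk1 : (1 : ℝ) ≤ k := by exact_mod_cast hk
  have hkq1 : (k : ℝ) + 1 ≤ q := by exact_mod_cast hkq
  have hqk0 : (0 : ℝ) < q - k := by linarith
  set u := (t + 2 * Real.pi * k) / q / 2 with hu
  -- Jordan's inequality at the nearer of the endpoints `0` and `π`. Since `|t| ≤ π` and `k ≥ 1`, `u
  -- ≥ π(2k-1)/(2q) ≥ πk/(2q)`; symmetrically for `π - u` with `q - k`.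
  have hsin : k / (q : ℝ) ≤ Real.sin u ∨ ((q : ℝ) - k) / q ≤ Real.sin u := by
    rcases le_total u (Real.pi / 2) with h | h
    · left
      have h1 : Real.pi * k / (2 * q) ≤ u := by
        rw [hu, div_div, mul_comm (q : ℝ)]
        gcongr
        nlinarith
      refine le_trans ?_ (Real.mul_le_sin (le_trans (by positivity) h1) h)
      calc k / (q : ℝ) = 2 / Real.pi * (Real.pi * k / (2 * q)) := by field_simp
        _ ≤ _ := by gcongr
    · right
      have h1 : Real.pi * (q - k) / (2 * q) ≤ Real.pi - u := by
        rw [hu, div_div, mul_comm (q : ℝ), div_le_iff₀ (by positivity), sub_mul,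
          div_mul_cancel₀ _ (by positivity)]
        nlinarith
      rw [← Real.sin_pi_sub]
      refine le_trans ?_ (Real.mul_le_sin (le_trans (by positivity) h1) (by linarith))
      calc ((q : ℝ) - k) / q = 2 / Real.pi * (Real.pi * (q - k) / (2 * q)) := by field_simp
        _ ≤ _ := by gcongr
  have hsin0 : 0 < Real.sin u := by
    rcases hsin with h | h <;> exact lt_of_lt_of_le (by positivity) h
  have hinv : 1 / (2 * Real.sin u) ≤ q / 2 * (1 / k + 1 / (q - k)) := by
    rcases hsin with h | h
    · calc 1 / (2 * Real.sin u) ≤ 1 / (2 * (k / q)) := by gcongr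
        _ = q / 2 * (1 / k) := by field_simp
        _ ≤ _ := by
          gcongr
          have : 0 < 1 / ((q : ℝ) - k) := by positivity
          linarith
    · calc 1 / (2 * Real.sin u) ≤ 1 / (2 * ((q - k) / q)) := by gcongr
        _ = q / 2 * (1 / (q - k)) := by field_simp
        _ ≤ _ := by
          gcongr
          have : 0 < 1 / (k : ℝ) := by positivity
          linarith
  set z := Complex.exp (Complex.I * ((-(2 * u) : ℝ) : ℂ)) with hz
  have hpow : ∀ b : ℕ, Complex.exp (Complex.I *
      ((-(b * ((t + 2 * Real.pi * k) / q)) : ℝ) : ℂ)) = z ^ b := fun b => by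
    rw [hz, ← Complex.exp_nat_mul, hu]
    congr 1
    push_cast
    ring
  have hzq : z ^ q = Complex.exp (Complex.I * ((-t : ℝ) : ℂ)) := by
    rw [← hpow, mul_div_cancel₀ _ hq0.ne', ← Complex.exp_periodic.sub_nat_mul_eq k
      (x := Complex.I * ((-t : ℝ) : ℂ))]
    congr 1
    push_cast
    ring
  have hz1 : ‖z - 1‖ = 2 * Real.sin u := by
    rw [hz, Complex.norm_exp_I_mul_ofReal_sub_one, show -(2 * u) / 2 = -u by ring, Real.sin_neg,
      mul_neg, norm_neg, Real.norm_of_nonneg (by positivity)]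
  have hgeom : ‖∑ b ∈ Finset.range q, z ^ b‖ * (2 * Real.sin u) ≤ |t| := by
    rw [← hz1, ← norm_mul, geom_sum_mul, hzq]
    exact Real.norm_exp_I_mul_ofReal_sub_one_le.trans (by simp)
  simp only [expCoeff, hpow]
  rw [norm_mul, norm_inv, Complex.norm_natCast, inv_mul_le_iff₀ hq0]
  calc _ ≤ |t| * (1 / (2 * Real.sin u)) := by
        rw [mul_one_div, le_div_iff₀ (by positivity)]; exact hgeom
    _ ≤ |t| * (q / 2 * (1 / k + 1 / (q - k))) := by gcongr
    _ = _ := by ring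

theorem sum_norm_expCoeff_le (Q : ℕ) {t : ℝ} (ht : |t| ≤ Real.pi) :
    ∑ k ∈ Finset.range Q, ‖expCoeff (Q + 1) t (k + 1)‖ ≤ |t| * (1 + Real.log ((Q : ℝ) + 1)) := by
  have hH : ∑ k ∈ Finset.range Q, (1 : ℝ) / (k + 1) ≤ 1 + Real.log ((Q : ℝ) + 1) := by
    have h1 := harmonic_le_one_add_log Q
    have h2 : Real.log Q ≤ Real.log ((Q : ℝ) + 1) := by
      rcases Nat.eq_zero_or_pos Q with rfl | hQ
      · simp
      · exact Real.log_le_log (by exact_mod_cast hQ) (by linarith)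
    simp only [harmonic] at h1
    push_cast at h1
    simp only [one_div]
    linarith
  have hrefl : ∑ k ∈ Finset.range Q, (1 : ℝ) / ((Q : ℝ) - k) =
      ∑ k ∈ Finset.range Q, (1 : ℝ) / (k + 1) := by
    rw [← Finset.sum_range_reflect]
    refine Finset.sum_congr rfl fun k hk => ?_
    have : k < Q := Finset.mem_range.1 hk
    rw [Nat.sub_sub, Nat.cast_sub (by omega)]
    push_cast
    congr 1
    ring
  calc _ ≤ ∑ k ∈ Finset.range Q, |t| / 2 * ((1 : ℝ) / (k + 1) + 1 / ((Q : ℝ) - k)) := by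
        refine Finset.sum_le_sum fun k hk => ?_
        refine (norm_expCoeff_le k.succ_pos
          (Nat.succ_lt_succ (Finset.mem_range.1 hk)) ht).trans (le_of_eq ?_)
        push_cast
        rw [add_sub_add_right_eq_sub]
    _ = |t| * ∑ k ∈ Finset.range Q, (1 : ℝ) / (k + 1) := by
        rw [← Finset.mul_sum, Finset.sum_add_distrib, hrefl]
        ring
    _ ≤ _ := mul_le_mul_of_nonneg_left hH (abs_nonneg t)

/-- For `a = np mod q`, the character `e^{2πika/q}` equals `e^{2πikpn/q}`, a pure exponential in `n`
of multiplier norm 1. Hence the norm is at most the `ℓ¹` norm of the coefficients, with 1 subtracted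
from the zeroth. -/
theorem isMult_exp_emod_sub_one (S : Set ℤ) (p : ℤ) {q : ℕ} (hq : 0 < q) {t : ℝ}
    (ht : |t| ≤ Real.pi) :
    IsMult S (fun n => Complex.exp (Complex.I *
        ((-(((n * p % q : ℤ) : ℝ) * (t / q)) : ℝ) : ℂ)) - 1)
      (|t| * (2 + Real.log q)) := by
  obtain ⟨Q, rfl⟩ : ∃ Q, q = Q + 1 := ⟨q - 1, by omega⟩
  have hq0 : ((Q + 1 : ℕ) : ℂ) ≠ 0 := by exact_mod_cast Q.succ_ne_zero
  have h1 := (IsMult.const S (expCoeff (Q + 1) t 0 - 1)).add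
    (IsMult.sum (Finset.range Q) fun k _ =>
      (IsMult.exp S (2 * Real.pi * (k + 1 : ℕ) * p / (Q + 1 : ℕ))).const_mul
        (expCoeff (Q + 1) t (k + 1)))
  refine (h1.congr fun n _ => ?_).mono ?_
  · obtain ⟨a, ha⟩ := Int.eq_ofNat_of_zero_le
      (Int.emod_nonneg (n * p) (by omega : ((Q + 1 : ℕ) : ℤ) ≠ 0))
    have haq : a < Q + 1 := by
      have := Int.emod_lt_of_pos (n * p) (by omega : (0 : ℤ) < ((Q + 1 : ℕ) : ℤ))
      omega
    have hdiv := Int.emod_add_mul_ediv (n * p) ((Q + 1 : ℕ) : ℤ)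
    rw [ha] at hdiv ⊢
    set m := n * p / ((Q + 1 : ℕ) : ℤ)
    have hexp : ∀ k : ℕ, Complex.exp
        (Complex.I * ((2 * Real.pi * k * a / (Q + 1 : ℕ) : ℝ) : ℂ)) =
        Complex.exp (Complex.I * ((2 * Real.pi * k * p / (Q + 1 : ℕ) * n : ℝ) : ℂ)) := by
      intro k
      rw [← Complex.exp_periodic.sub_int_mul_eq (k * m)
        (x := Complex.I * ((2 * Real.pi * k * p / (Q + 1 : ℕ) * n : ℝ) : ℂ))]
      have hc : (n : ℂ) * p = a + (Q + 1 : ℕ) * m := by exact_mod_cast hdiv.symm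
      congr 1
      have : (a : ℂ) = n * p - (Q + 1 : ℕ) * m := by rw [hc]; ring
      push_cast at this hq0 ⊢
      rw [this]
      field_simp
    have := sum_expCoeff_mul_exp t a haq
    simp only [Finset.sum_range_succ', hexp] at this
    rw [Int.cast_natCast, ← this]
    simp
    ring
  · have := sum_norm_expCoeff_le Q ht
    have h0 := norm_expCoeff_zero_sub_one_le Q.succ_pos t
    simp only [mul_one]
    push_cast at this h0 ⊢
    linarith

/-! ### Multiplier bounds for the rounded phases. -/

/-- A majorant for the `L¹`-norm of the Dirichlet kernel with about `p` terms. -/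
noncomputable def kernelWeight (p t : ℝ) : ℝ := Real.log (p + 1) + p / (1 + p * |t|)

theorem log_add_one_nonneg {p : ℝ} (hp : 1 ≤ p) : 1 / 2 ≤ Real.log (p + 1) := by
  have h1 := Real.log_two_gt_d9
  have h2 : Real.log 2 ≤ Real.log (p + 1) := Real.log_le_log two_pos (by linarith)
  linarith

/-- Merges the trivial bound 2, used for `x ≥ 1`, with the linear bound for `x ≤ 1`. -/
theorem le_mul_div_one_add {A B x : ℝ} (hx : 0 ≤ x) (hB : 0 ≤ B) (h2 : A ≤ 2)
    (h1 : x ≤ 1 → A ≤ B * x) : A ≤ (4 + 2 * B) * (x / (1 + x)) := by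
  rw [mul_div_assoc', le_div_iff₀ (by linarith)]
  rcases le_total x 1 with h | h
  · have := h1 h
    nlinarith [mul_nonneg hB hx]
  · nlinarith [mul_nonneg hB hx]

theorem mul_div_one_add_le_kernelWeight {p t : ℝ} (hp : 1 ≤ p) :
    p * |t| / (1 + p * |t|) ≤ |t| * kernelWeight p t := by
  have := log_add_one_nonneg hp
  have h : p * |t| / (1 + p * |t|) = |t| * (p / (1 + p * |t|)) := by ring
  rw [h, kernelWeight]
  exact mul_le_mul_of_nonneg_left (by linarith) (abs_nonneg t)

theorem norm_exp_sub_one_le_kernelWeight {s p t x : ℝ} (hs : 0 ≤ s) (hp : 1 ≤ p) (hx0 : 0 ≤ x)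
    (hx : x ≤ s * p + 1) :
    ‖Complex.exp (Complex.I * ((x * t : ℝ) : ℂ)) - 1‖ ≤
      (6 + 2 * s) * (|t| * kernelWeight p t) := by
  have h1 : ‖Complex.exp (Complex.I * ((x * t : ℝ) : ℂ)) - 1‖ ≤ 2 := by
    refine (norm_sub_le _ _).trans ?_
    rw [Complex.norm_exp_I_mul_ofReal, norm_one]
    norm_num
  have h2 : ‖Complex.exp (Complex.I * ((x * t : ℝ) : ℂ)) - 1‖ ≤ (s + 1) * (p * |t|) := by
    refine Real.norm_exp_I_mul_ofReal_sub_one_le.trans ?_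
    rw [Real.norm_eq_abs, abs_mul, abs_of_nonneg hx0, ← mul_assoc]
    exact mul_le_mul_of_nonneg_right (by nlinarith) (abs_nonneg t)
  refine (le_mul_div_one_add (x := p * |t|) (by positivity) (by positivity) h1
    fun _ => h2).trans ?_
  refine le_trans (le_of_eq ?_) (mul_le_mul_of_nonneg_left (mul_div_one_add_le_kernelWeight hp)
    (by positivity))
  ring

theorem isMult_exp_mul_div_sub_one {s p t : ℝ} {q : ℕ} (hs : 0 < s) (hp : 1 ≤ p) (hq : 0 < q) :
    IsMult {n | 0 ≤ (n : ℝ) / q ∧ (n : ℝ) / q ≤ s}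
      (fun n => Complex.exp (Complex.I * ((p * t / q * n : ℝ) : ℂ)) - 1)
      ((4 + 4 * s * Real.exp (2 * s)) * (|t| * kernelWeight p t)) := by
  have hq0 : (0 : ℝ) < q := by exact_mod_cast hq
  set S : Set ℤ := {n | 0 ≤ (n : ℝ) / q ∧ (n : ℝ) / q ≤ s}
  have h2 : IsMult S (fun n => Complex.exp (Complex.I * ((p * t / q * n : ℝ) : ℂ)) - 1) 2 :=
    (((IsMult.exp S (p * t / q)).add (IsMult.const S (-1))).congr fun n _ => by ring).mono
      (by norm_num)
  have h1 : IsMult S (fun n => Complex.exp (Complex.I * ((p * t / q * n : ℝ) : ℂ)) - 1)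
      (Real.exp |2 * s * p * t| - 1) := by
    -- Dividing by `2s` moves `n/q` from `[0, s]` into `[0, 1/2]`; the factor `2s` reappears in `τ`.
    refine (isMult_exp_linear_sub_one (α := 1 / (2 * s * q)) (fun n hn => ?_)
      (2 * s * p * t)).congr fun n _ => ?_
    · have : 1 / (2 * s * q) * (n : ℝ) = (n : ℝ) / q / (2 * s) := by field_simp
      rw [this]
      refine ⟨div_nonneg hn.1 (by positivity), ?_⟩
      rw [div_le_iff₀ (by positivity)]
      linarith [hn.2]
    · congr 4
      field_simp
  refine (show IsMult S _ (min 2 (Real.exp |2 * s * p * t| - 1)) by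
    rcases min_choice 2 (Real.exp |2 * s * p * t| - 1) with h | h <;> rw [h] <;> assumption).mono ?_
  refine (le_mul_div_one_add (x := p * |t|) (B := 2 * s * Real.exp (2 * s)) (by positivity)
    (by positivity) (min_le_left _ _) fun hx => (min_le_right _ _).trans ?_).trans ?_
  · have habs : |2 * s * p * t| = 2 * s * (p * |t|) := by
      rw [abs_mul, abs_of_nonneg (by positivity : 0 ≤ 2 * s * p), mul_assoc]
    rw [habs]
    set y := 2 * s * (p * |t|) with hy
    have hy0 : 0 ≤ y := by positivity
    have hys : y ≤ 2 * s := by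
      rw [hy]; exact mul_le_of_le_one_right (by positivity) hx
    have e1 : Real.exp y - 1 ≤ y * Real.exp y := by
      have := Real.add_one_le_exp (-y)
      have h3 := mul_le_mul_of_nonneg_right this (Real.exp_pos y).le
      rw [← Real.exp_add, neg_add_cancel, Real.exp_zero] at h3
      linarith
    have e2 : y * Real.exp y ≤ y * Real.exp (2 * s) := by gcongr
    calc _ ≤ y * Real.exp (2 * s) := e1.trans e2
      _ = _ := by rw [hy]; ring
  · refine le_trans (le_of_eq ?_) (mul_le_mul_of_nonneg_left
      (mul_div_one_add_le_kernelWeight hp) (by positivity))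
    ring

theorem abs_mul_log_le_kernelWeight {p q : ℕ} (hq : 0 < q) (hqp : q ≤ p) (t : ℝ) :
    |t| * (3 + Real.log q) ≤ 7 * (|t| * kernelWeight p t) := by
  have hq0 : (0 : ℝ) < q := by exact_mod_cast hq
  have hqp' : (q : ℝ) ≤ p := by exact_mod_cast hqp
  have hp : (1 : ℝ) ≤ p := by exact_mod_cast hq.trans_le hqp
  have h1 := log_add_one_nonneg hp
  have h2 : Real.log q ≤ Real.log ((p : ℝ) + 1) := Real.log_le_log hq0 (by linarith)
  have h3 : 0 ≤ (p : ℝ) / (1 + p * |t|) := by positivity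
  rw [← mul_assoc, mul_comm 7, mul_assoc, kernelWeight]
  exact mul_le_mul_of_nonneg_left (by linarith) (abs_nonneg t)

theorem isMult_exp_floor_sub_one {s t : ℝ} {p q : ℕ} (hs : 0 < s) (hq : 0 < q) (hqp : q ≤ p)
    (ht : |t| ≤ Real.pi) :
    IsMult {n | 0 ≤ (n : ℝ) / q ∧ (n : ℝ) / q ≤ s}
      (fun n => Complex.exp (Complex.I * (((⌊p * ((n : ℝ) / q)⌋ + 1 : ℤ) * t : ℝ) : ℂ)) - 1)
      ((11 + 4 * s * Real.exp (2 * s)) * (|t| * kernelWeight p t)) := by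
  have hq0 : (q : ℂ) ≠ 0 := by exact_mod_cast hq.ne'
  have hp : (1 : ℝ) ≤ p := by exact_mod_cast hq.trans_le hqp
  set S : Set ℤ := {n | 0 ≤ (n : ℝ) / q ∧ (n : ℝ) / q ≤ s}
  have h1 := isMult_exp_emod_sub_one S p hq ht
  have h2 := isMult_exp_mul_div_sub_one (t := t) hs hp hq
  have h0 : 0 ≤ |t| * (2 + Real.log q) := by
    have : 0 ≤ Real.log q := Real.log_natCast_nonneg q
    positivity
  -- With `u` the residue phase and `v` the linear phase, `uv - 1 = (u - 1)v + (v - 1)`. The extra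
  -- `+ 1` in the exponent is handled by `e^{it}w - 1 = e^{it}(w - 1) + (e^{it} - 1)`.
  have h3 := (((h1.mul (IsMult.exp S (p * t / q)) h0).add h2).const_mul
    (Complex.exp (Complex.I * (t : ℂ)))).add
      (IsMult.const S (Complex.exp (Complex.I * (t : ℂ)) - 1))
  refine (h3.congr fun n _ => ?_).mono ?_
  · have hfl : ⌊(p : ℝ) * ((n : ℝ) / q)⌋ = n * p / (q : ℤ) := by
      rw [show (p : ℝ) * ((n : ℝ) / q) = ((n * p : ℤ) : ℝ) / q by push_cast; ring,
        Int.floor_div_natCast, Int.floor_intCast]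
    have hdiv : ((n * p % q : ℤ) : ℂ) + q * ((n * p / q : ℤ) : ℂ) = n * p := by
      exact_mod_cast Int.emod_add_mul_ediv (n * p) q
    have e : Complex.exp (Complex.I * (((⌊p * ((n : ℝ) / q)⌋ + 1 : ℤ) * t : ℝ) : ℂ)) =
        Complex.exp (Complex.I * (t : ℂ)) * (Complex.exp (Complex.I *
          ((-(((n * p % q : ℤ) : ℝ) * (t / q)) : ℝ) : ℂ)) *
            Complex.exp (Complex.I * ((p * t / q * n : ℝ) : ℂ))) := by
      rw [hfl, ← Complex.exp_add, ← Complex.exp_add]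
      congr 1
      push_cast
      have : ((n * p % q : ℤ) : ℂ) = n * p - q * ((n * p / q : ℤ) : ℂ) := by rw [← hdiv]; ring
      rw [this]
      field_simp
      ring
    rw [e]
    ring
  · have e1 : ‖Complex.exp (Complex.I * (t : ℂ)) - 1‖ ≤ |t| :=
      Real.norm_exp_I_mul_ofReal_sub_one_le
    have := abs_mul_log_le_kernelWeight hq hqp t
    rw [Complex.norm_exp_I_mul_ofReal]
    linarith

/-- Since `⌈y⌉ = -⌊-y⌋`, the residue phase is used with `-p` and `-t`. -/
theorem isMult_exp_ceil_sub_one {s t : ℝ} {p q : ℕ} (hs : 0 < s) (hq : 0 < q) (hqp : q ≤ p)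
    (ht : |t| ≤ Real.pi) :
    IsMult {n | 0 ≤ (n : ℝ) / q ∧ (n : ℝ) / q ≤ s}
      (fun n => Complex.exp (Complex.I * (((⌈p * ((n : ℝ) / q)⌉ : ℤ) * t : ℝ) : ℂ)) - 1)
      ((11 + 4 * s * Real.exp (2 * s)) * (|t| * kernelWeight p t)) := by
  have hq0 : (q : ℂ) ≠ 0 := by exact_mod_cast hq.ne'
  have hp : (1 : ℝ) ≤ p := by exact_mod_cast hq.trans_le hqp
  set S : Set ℤ := {n | 0 ≤ (n : ℝ) / q ∧ (n : ℝ) / q ≤ s}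
  have h1 := isMult_exp_emod_sub_one S (-p) hq (t := -t) (by rwa [abs_neg])
  have h2 := isMult_exp_mul_div_sub_one (t := t) hs hp hq
  have h0 : 0 ≤ |-t| * (2 + Real.log q) := by
    have : 0 ≤ Real.log q := Real.log_natCast_nonneg q
    positivity
  have h3 := (h1.mul (IsMult.exp S (p * t / q)) h0).add h2
  refine (h3.congr fun n _ => ?_).mono ?_
  · have hfl : ⌈(p : ℝ) * ((n : ℝ) / q)⌉ = -(n * -p / (q : ℤ)) := by
      rw [show (p : ℝ) * ((n : ℝ) / q) = -(((n * -p : ℤ) : ℝ) / q) by push_cast; ring,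
        Int.ceil_neg, Int.floor_div_natCast, Int.floor_intCast]
    have hdiv : ((n * -p % q : ℤ) : ℂ) + q * ((n * -p / q : ℤ) : ℂ) = n * -p := by
      exact_mod_cast Int.emod_add_mul_ediv (n * -p) q
    have e : Complex.exp (Complex.I * (((⌈p * ((n : ℝ) / q)⌉ : ℤ) * t : ℝ) : ℂ)) =
        Complex.exp (Complex.I * ((-(((n * -p % q : ℤ) : ℝ) * (-t / q)) : ℝ) : ℂ)) *
          Complex.exp (Complex.I * ((p * t / q * n : ℝ) : ℂ)) := by
      rw [hfl, ← Complex.exp_add]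
      congr 1
      push_cast
      have : ((n * -p % q : ℤ) : ℂ) = n * -p - q * ((n * -p / q : ℤ) : ℂ) := by rw [← hdiv]; ring
      rw [this]
      field_simp
      ring
    rw [e]
    ring
  · have := abs_mul_log_le_kernelWeight hq hqp t
    rw [abs_neg]
    linarith [abs_nonneg t]

/-! ### Removing one coordinate from the chain. -/

/-- The chain condition `r ≤ y_d ≤ ⋯ ≤ y_1 ≤ s`. -/
def IsChainIn {d : ℕ} (r s : ℝ) (y : Fin d → ℝ) : Prop :=
  (∀ i, r ≤ y i) ∧ (∀ i k, i ≤ k → y k ≤ y i) ∧ ∀ i, y i ≤ s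

/-- The largest value which can be inserted at position `j` into the chain `y`. -/
noncomputable def upperNeighbor {d : ℕ} (s : ℝ) (j : Fin (d + 1)) (y : Fin d → ℝ) : ℝ :=
  if h : j = 0 then s else y (j.pred h)

/-- The smallest value which can be inserted at position `j` into the chain `y`. -/
noncomputable def lowerNeighbor {d : ℕ} (r : ℝ) (j : Fin (d + 1)) (y : Fin d → ℝ) : ℝ :=
  if h : j = Fin.last d then r else y (j.castPred h)

theorem IsChainIn.bounds_upperNeighbor {d : ℕ} {r s : ℝ} (hrs : r ≤ s) (j : Fin (d + 1))
    {y : Fin d → ℝ} (hy : IsChainIn r s y) :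
    r ≤ upperNeighbor s j y ∧ upperNeighbor s j y ≤ s := by
  unfold upperNeighbor
  split_ifs
  · exact ⟨hrs, le_rfl⟩
  · exact ⟨hy.1 _, hy.2.2 _⟩

theorem IsChainIn.bounds_lowerNeighbor {d : ℕ} {r s : ℝ} (hrs : r ≤ s) (j : Fin (d + 1))
    {y : Fin d → ℝ} (hy : IsChainIn r s y) :
    r ≤ lowerNeighbor r j y ∧ lowerNeighbor r j y ≤ s := by
  unfold lowerNeighbor
  split_ifs
  · exact ⟨le_rfl, hrs⟩
  · exact ⟨hy.1 _, hy.2.2 _⟩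

theorem IsChainIn.lowerNeighbor_le_upperNeighbor {d : ℕ} {r s : ℝ} (hrs : r ≤ s)
    (j : Fin (d + 1)) {y : Fin d → ℝ} (hy : IsChainIn r s y) :
    lowerNeighbor r j y ≤ upperNeighbor s j y := by
  by_cases h : j = 0
  · rw [upperNeighbor, dif_pos h]
    exact (hy.bounds_lowerNeighbor hrs j).2
  by_cases h' : j = Fin.last d
  · rw [lowerNeighbor, dif_pos h']
    exact (hy.bounds_upperNeighbor hrs j).1
  rw [upperNeighbor, lowerNeighbor, dif_neg h, dif_neg h']
  refine hy.2.1 _ _ ?_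
  rw [Fin.le_def, Fin.val_pred, Fin.coe_castPred]
  omega

theorem isChainIn_insertNth {d : ℕ} {r s : ℝ} (hrs : r ≤ s) (j : Fin (d + 1)) (x : ℝ)
    (y : Fin d → ℝ) :
    IsChainIn r s (Fin.insertNth j x y : Fin (d + 1) → ℝ) ↔
      IsChainIn r s y ∧ lowerNeighbor r j y ≤ x ∧ x ≤ upperNeighbor s j y := by
  constructor
  · rintro ⟨h1, h2, h3⟩
    refine ⟨⟨fun i => by simpa using h1 (j.succAbove i), fun i k hik => ?_,
      fun i => by simpa using h3 (j.succAbove i)⟩, ?_, ?_⟩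
    · simpa using h2 _ _ ((Fin.strictMono_succAbove j).monotone hik)
    · unfold lowerNeighbor
      split_ifs with h
      · simpa using h1 j
      · have := h2 j (j.succAbove (j.castPred h)) (by
          refine le_of_lt ((Fin.lt_succAbove_iff_le_castSucc _ _).2 ?_)
          simp)
        simpa only [Fin.insertNth_apply_same, Fin.insertNth_apply_succAbove] using this
    · unfold upperNeighbor
      split_ifs with h
      · simpa using h3 j
      · have := h2 (j.succAbove (j.pred h)) j (by
          refine le_of_lt ((Fin.succAbove_lt_iff_succ_le _ _).2 ?_)
          simp)
        simpa only [Fin.insertNth_apply_same, Fin.insertNth_apply_succAbove] using this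
  · rintro ⟨hy, hl, hu⟩
    refine ⟨fun i => ?_, fun i k hik => ?_, fun i => ?_⟩
    · rcases Fin.eq_self_or_eq_succAbove j i with rfl | ⟨i, rfl⟩
      · simpa using (hy.bounds_lowerNeighbor hrs i).1.trans hl
      · simpa using hy.1 i
    · rcases Fin.eq_self_or_eq_succAbove j i with rfl | ⟨i, rfl⟩
      · rcases Fin.eq_self_or_eq_succAbove i k with rfl | ⟨k, rfl⟩
        · exact le_rfl
        · have hne : i ≠ Fin.last d := by
            rintro rfl
            exact Fin.succAbove_ne _ _ (Fin.last_le_iff.1 hik)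
          have hlt := (Fin.lt_succAbove_iff_le_castSucc _ _).1
            (lt_of_le_of_ne hik (Fin.succAbove_ne _ _).symm)
          rw [lowerNeighbor, dif_neg hne] at hl
          simpa using (hy.2.1 (i.castPred hne) k (by simpa [Fin.le_def] using hlt)).trans hl
      · rcases Fin.eq_self_or_eq_succAbove j k with rfl | ⟨k, rfl⟩
        · have hne : k ≠ 0 := by
            rintro rfl
            exact Fin.succAbove_ne _ _ (Fin.le_zero_iff.1 hik)
          have hlt := (Fin.succAbove_lt_iff_succ_le _ _).1
            (lt_of_le_of_ne hik (Fin.succAbove_ne _ _))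
          rw [upperNeighbor, dif_neg hne] at hu
          simpa using hu.trans (hy.2.1 i (k.pred hne) (by
            rw [Fin.le_def, Fin.val_succ] at hlt
            rw [Fin.le_def, Fin.val_pred]
            omega))
        · simpa using hy.2.1 i k ((Fin.strictMono_succAbove j).le_iff_le.1 hik)
    · rcases Fin.eq_self_or_eq_succAbove j i with rfl | ⟨i, rfl⟩
      · simpa using hu.trans (hy.bounds_upperNeighbor hrs i).2
      · simpa using hy.2.2 i

theorem mem_polyhedralFinset {d : ℕ} {r s : ℝ} {m : Fin d → ℕ} {hm : ∀ i, 0 < m i}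
    {γ : Fin d → ℤ} :
    γ ∈ polyhedralFinset r s m hm ↔ IsChainIn r s fun i => (γ i : ℝ) / m i := by
  rw [polyhedralFinset, Set.Finite.mem_toFinset]
  rfl

/-- Telescoping; `a = b + 1` is the empty interval, where both sides vanish. This case occurs when
no integer lies between the rounded bounds. -/
theorem mul_sum_Icc_exp (x : ℝ) {a b : ℤ} (hab : a ≤ b + 1) :
    (Complex.exp (Complex.I * (x : ℂ)) - 1) *
      ∑ n ∈ Finset.Icc a b, Complex.exp (Complex.I * ((n * x : ℝ) : ℂ)) =
      Complex.exp (Complex.I * (((b + 1 : ℤ) * x : ℝ) : ℂ)) -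
        Complex.exp (Complex.I * ((a * x : ℝ) : ℂ)) := by
  obtain ⟨N, hN⟩ := Int.eq_ofNat_of_zero_le (sub_nonneg.2 hab)
  obtain rfl : b = a + N - 1 := by omega
  clear hab hN
  induction N with
  | zero => simp
  | succ N ih =>
    have hI : Finset.Icc a (a + (N + 1 : ℕ) - 1) =
        insert (a + (N : ℤ)) (Finset.Icc a (a + N - 1)) := by
      ext n
      simp only [Finset.mem_Icc, Finset.mem_insert]
      omega
    rw [hI, Finset.sum_insert (by simp), mul_add, ih]
    have h1 : Complex.exp (Complex.I * (((a + (N + 1 : ℕ) - 1 + 1 : ℤ) * x : ℝ) : ℂ)) =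
        Complex.exp (Complex.I * (x : ℂ)) *
          Complex.exp (Complex.I * (((a + N : ℤ) * x : ℝ) : ℂ)) := by
      rw [← Complex.exp_add]
      congr 1
      push_cast
      ring
    rw [h1, sub_add_cancel]
    ring

section Elimination

variable {d : ℕ} {r s : ℝ} {m : Fin (d + 1) → ℕ}

theorem sum_polyhedralFinset_succ (hrs : r ≤ s) (hm : ∀ i, 0 < m i) (j : Fin (d + 1))
    (F : (Fin (d + 1) → ℤ) → ℂ) :
    ∑ γ ∈ polyhedralFinset r s m hm, F γ =
      ∑ γ ∈ polyhedralFinset r s (fun i => m (j.succAbove i)) (fun _ => hm _),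
        ∑ n ∈ Finset.Icc ⌈m j * lowerNeighbor r j fun i => (γ i : ℝ) / m (j.succAbove i)⌉
          ⌊m j * upperNeighbor s j fun i => (γ i : ℝ) / m (j.succAbove i)⌋,
          F (Fin.insertNth j n γ) := by
  have hmj : (0 : ℝ) < m j := by exact_mod_cast hm j
  have hmem : ∀ (n : ℤ) (γ : Fin d → ℤ),
      Fin.insertNth j n γ ∈ polyhedralFinset r s m hm ↔
        γ ∈ polyhedralFinset r s (fun i => m (j.succAbove i)) (fun _ => hm _) ∧
        n ∈ Finset.Icc ⌈m j * lowerNeighbor r j fun i => (γ i : ℝ) / m (j.succAbove i)⌉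
          ⌊m j * upperNeighbor s j fun i => (γ i : ℝ) / m (j.succAbove i)⌋ := by
    intro n γ
    have he : (fun i => (((Fin.insertNth j n γ : Fin (d + 1) → ℤ) i : ℤ) : ℝ) / m i) =
        (Fin.insertNth j ((n : ℝ) / m j) fun i => (γ i : ℝ) / m (j.succAbove i) :
          Fin (d + 1) → ℝ) := by
      funext i
      rcases Fin.eq_self_or_eq_succAbove j i with rfl | ⟨i, rfl⟩ <;> simp
    rw [mem_polyhedralFinset, he, isChainIn_insertNth hrs, mem_polyhedralFinset, Finset.mem_Icc,
      Int.ceil_le, Int.le_floor, le_div_iff₀' hmj, div_le_iff₀' hmj]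
  rw [Finset.sum_sigma']
  refine Finset.sum_bij' (fun γ _ => ⟨fun i => γ (j.succAbove i), γ j⟩)
    (fun z _ => Fin.insertNth j z.2 z.1) (fun γ hγ => ?_) (fun z hz => ?_) (fun γ _ => ?_)
    (fun z _ => ?_) (fun γ _ => ?_)
  · rw [Finset.mem_sigma, ← hmem]
    convert hγ
    exact Fin.insertNth_self_removeNth j γ
  · exact (hmem _ _).2 (Finset.mem_sigma.1 hz)
  · exact Fin.insertNth_self_removeNth j γ
  · simp
  · exact congrArg F (Fin.insertNth_self_removeNth j γ).symm

theorem exp_sub_one_mul_trigPoly (hrs : r ≤ s) (hm : ∀ i, 0 < m i) (j : Fin (d + 1)) (x : ℝ)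
    (t : Fin d → ℝ) :
    (Complex.exp (Complex.I * (x : ℂ)) - 1) *
        trigPoly (polyhedralFinset r s m hm) (fun _ => 1) (Fin.insertNth j x t) =
      trigPoly (polyhedralFinset r s (fun i => m (j.succAbove i)) fun _ => hm _)
        (fun γ => (Complex.exp (Complex.I * (((⌊m j * upperNeighbor s j
            fun i => (γ i : ℝ) / m (j.succAbove i)⌋ + 1 : ℤ) * x : ℝ) : ℂ)) - 1) +
          (-1) * (Complex.exp (Complex.I * ((⌈m j * lowerNeighbor r j
            fun i => (γ i : ℝ) / m (j.succAbove i)⌉ * x : ℝ) : ℂ)) - 1)) t := by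
  unfold trigPoly
  rw [sum_polyhedralFinset_succ hrs hm j, Finset.mul_sum]
  refine Finset.sum_congr rfl fun γ hγ => ?_
  have hle := (mem_polyhedralFinset.1 hγ).lowerNeighbor_le_upperNeighbor hrs j
  have hab : ⌈(m j : ℝ) * lowerNeighbor r j fun i => (γ i : ℝ) / m (j.succAbove i)⌉ ≤
      ⌊(m j : ℝ) * upperNeighbor s j fun i => (γ i : ℝ) / m (j.succAbove i)⌋ + 1 := by
    rw [Int.ceil_le]
    push_cast
    exact (mul_le_mul_of_nonneg_left hle (Nat.cast_nonneg _)).trans (Int.lt_floor_add_one _).le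
  have := mul_sum_Icc_exp x hab
  dsimp only
  -- Subtracting 1 from each end phase separately makes each of them small near `x = 0`, so they can
  -- be estimated independently.
  rw [show ∀ u v : ℂ, (u - 1) + (-1) * (v - 1) = u - v from fun u v => by ring, ← this, mul_assoc,
    Finset.sum_mul]
  congr 1
  refine Finset.sum_congr rfl fun n _ => ?_
  rw [one_mul, ← Complex.exp_add, Fin.sum_univ_succAbove _ j]
  simp only [Fin.insertNth_apply_same, Fin.insertNth_apply_succAbove]
  congr 1
  push_cast
  ring

end Elimination

/-! ### Integrating the weight. -/

theorem continuous_kernelWeight {p : ℝ} (hp : 0 ≤ p) : Continuous (kernelWeight p) := by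
  unfold kernelWeight
  refine continuous_const.add (continuous_const.div (by fun_prop) fun t => ?_)
  positivity

theorem kernelWeight_nonneg {p : ℝ} (hp : 1 ≤ p) (t : ℝ) : 0 ≤ kernelWeight p t := by
  have := log_add_one_nonneg hp
  unfold kernelWeight
  positivity

theorem integrable_kernelWeight {p : ℝ} (hp : 0 ≤ p) :
    Integrable (kernelWeight p) circleMeasure :=
  ((continuous_kernelWeight hp).integrableOn_Icc (a := -Real.pi) (b := Real.pi)).mono_set
    Ico_subset_Icc_self

theorem integral_kernelWeight_le {p : ℝ} (hp : 1 ≤ p) :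
    ∫ t, kernelWeight p t ∂circleMeasure ≤ (2 * Real.pi + 6) * Real.log (p + 1) := by
  have hpi := Real.pi_pos
  have hc : Continuous fun t : ℝ => p / (1 + p * |t|) :=
    continuous_const.div (by fun_prop) fun t => by positivity
  have hhalf : ∫ t in (0)..Real.pi, p / (1 + p * |t|) = Real.log (1 + p * Real.pi) := by
    have hcongr : ∫ t in (0)..Real.pi, p / (1 + p * |t|) = ∫ t in (0)..Real.pi, p / (1 + p * t) :=
      intervalIntegral.integral_congr fun t ht => by
        rw [uIcc_of_le hpi.le] at ht
        simp only [abs_of_nonneg ht.1]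
    have hpos : ∀ t ∈ uIcc 0 Real.pi, 1 + p * t ≠ 0 := fun t ht => by
      rw [uIcc_of_le hpi.le] at ht
      have := mul_nonneg (zero_le_one.trans hp) ht.1
      linarith
    rw [hcongr, intervalIntegral.integral_eq_sub_of_hasDerivAt
      (f := fun t => Real.log (1 + p * t)) (f' := fun t => p / (1 + p * t)) (fun t ht => ?_)
      (ContinuousOn.intervalIntegrable (ContinuousOn.div (by fun_prop) (by fun_prop) hpos))]
    · simp
    · simpa using (((hasDerivAt_id t).const_mul p).const_add 1).log (hpos t ht)
  have hneg : ∫ t in (-Real.pi)..0, p / (1 + p * |t|) = Real.log (1 + p * Real.pi) := by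
    rw [← hhalf]
    have := intervalIntegral.integral_comp_neg (a := 0) (b := Real.pi)
      fun t : ℝ => p / (1 + p * |t|)
    simpa using this.symm
  -- `1 + pπ ≤ (p + 1)³`, from `π < 4` and `p ≥ 1`.
  have hlog : Real.log (1 + p * Real.pi) ≤ 3 * Real.log (p + 1) := by
    rw [← Nat.cast_ofNat, ← Real.log_pow]
    refine Real.log_le_log (by positivity) ?_
    nlinarith [Real.pi_lt_four, pow_pos (zero_lt_one.trans_le hp) 3]
  unfold circleMeasure
  rw [integral_Ico_eq_integral_Ioc, ← intervalIntegral.integral_of_le (by linarith)]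
  unfold kernelWeight
  rw [intervalIntegral.integral_add intervalIntegrable_const (hc.intervalIntegrable _ _),
    intervalIntegral.integral_const,
    ← intervalIntegral.integral_add_adjacent_intervals (hc.intervalIntegrable _ 0)
      (hc.intervalIntegrable 0 _), hneg, hhalf, smul_eq_mul]
  linarith

theorem two_div_pi_mul_abs_le_norm_exp_sub_one {x : ℝ} (hx : |x| ≤ Real.pi) :
    2 / Real.pi * |x| ≤ ‖Complex.exp (Complex.I * (x : ℂ)) - 1‖ := by
  rw [Complex.norm_exp_I_mul_ofReal_sub_one, norm_mul, Real.norm_ofNat]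
  have := Real.mul_abs_le_abs_sin (x := x / 2) (by
    rw [abs_div, abs_two]; linarith)
  rw [abs_div, abs_two] at this
  rw [Real.norm_eq_abs]
  linarith

/-! ### Cost of eliminating the largest coordinate. -/

section Elimination

variable {d : ℕ} {r s : ℝ} {m : Fin (d + 1) → ℕ}

/-- At the end of the chain (`j = 0`) the upper bound is the constant `s`, so the phase is a scalar;
otherwise it is a multiplier in the neighbouring coordinate. The constant is chosen to cover both
cases. -/
theorem trigNorm_upper_le (hr : 0 ≤ r) (hrs : r < s) (hm : ∀ i, 0 < m i) (j : Fin (d + 1))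
    (hj : ∀ i, m i ≤ m j) {x : ℝ} (hx : |x| ≤ Real.pi) :
    trigNorm (polyhedralFinset r s (fun i => m (j.succAbove i)) fun _ => hm _)
      (fun γ => Complex.exp (Complex.I * (((⌊m j * upperNeighbor s j
        fun i => (γ i : ℝ) / m (j.succAbove i)⌋ + 1 : ℤ) * x : ℝ) : ℂ)) - 1) ≤
      (11 + 4 * s * Real.exp (2 * s) + 2 * s) * (|x| * kernelWeight (m j) x) *
        trigNorm (polyhedralFinset r s (fun i => m (j.succAbove i)) fun _ => hm _) fun _ => 1 := by
  have hs : 0 < s := hr.trans_lt hrs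
  have hp : (1 : ℝ) ≤ m j := by exact_mod_cast hm j
  have hw := mul_nonneg (abs_nonneg x) (kernelWeight_nonneg hp x)
  by_cases h : j = 0
  · simp only [upperNeighbor, dif_pos h]
    have h1 := norm_exp_sub_one_le_kernelWeight (t := x) (x := (⌊m j * s⌋ + 1 : ℤ)) hs.le hp
      (by positivity) (by
        push_cast
        linarith [Int.floor_le ((m j : ℝ) * s)])
    have h2 := trigNorm_smul (polyhedralFinset r s (fun i => m (j.succAbove i)) fun _ => hm _)
      (fun _ => 1) (Complex.exp (Complex.I * (((⌊m j * s⌋ + 1 : ℤ) * x : ℝ) : ℂ)) - 1)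
    simp only [mul_one] at h2
    rw [h2]
    refine mul_le_mul_of_nonneg_right (h1.trans (mul_le_mul_of_nonneg_right ?_ hw))
      (trigNorm_nonneg _ _)
    have : 0 ≤ 4 * s * Real.exp (2 * s) := by positivity
    linarith
  · simp only [upperNeighbor, dif_neg h]
    have h1 := (isMult_exp_floor_sub_one hs (hm (j.succAbove (j.pred h))) (hj _) hx).mono
      (mul_le_mul_of_nonneg_right (show 11 + 4 * s * Real.exp (2 * s) ≤
        11 + 4 * s * Real.exp (2 * s) + 2 * s by linarith) hw) d
      (polyhedralFinset r s (fun i => m (j.succAbove i)) fun _ => hm _) (j.pred h) (fun _ => 1)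
      fun γ hγ => by
        have hγ := mem_polyhedralFinset.1 hγ
        exact ⟨hr.trans (hγ.1 _), hγ.2.2 _⟩
    simpa only [one_mul] using h1

theorem trigNorm_lower_le (hr : 0 ≤ r) (hrs : r < s) (hm : ∀ i, 0 < m i) (j : Fin (d + 1))
    (hj : ∀ i, m i ≤ m j) {x : ℝ} (hx : |x| ≤ Real.pi) :
    trigNorm (polyhedralFinset r s (fun i => m (j.succAbove i)) fun _ => hm _)
      (fun γ => Complex.exp (Complex.I * ((⌈m j * lowerNeighbor r j
        fun i => (γ i : ℝ) / m (j.succAbove i)⌉ * x : ℝ) : ℂ)) - 1) ≤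
      (11 + 4 * s * Real.exp (2 * s) + 2 * s) * (|x| * kernelWeight (m j) x) *
        trigNorm (polyhedralFinset r s (fun i => m (j.succAbove i)) fun _ => hm _) fun _ => 1 := by
  have hs : 0 < s := hr.trans_lt hrs
  have hp : (1 : ℝ) ≤ m j := by exact_mod_cast hm j
  have hw := mul_nonneg (abs_nonneg x) (kernelWeight_nonneg hp x)
  by_cases h : j = Fin.last d
  · simp only [lowerNeighbor, dif_pos h]
    have h1 := norm_exp_sub_one_le_kernelWeight (t := x) (x := (⌈m j * r⌉ : ℤ)) hs.le hp
      (by positivity) (by nlinarith [Int.ceil_lt_add_one ((m j : ℝ) * r)])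
    have h2 := trigNorm_smul (polyhedralFinset r s (fun i => m (j.succAbove i)) fun _ => hm _)
      (fun _ => 1) (Complex.exp (Complex.I * ((⌈m j * r⌉ * x : ℝ) : ℂ)) - 1)
    simp only [mul_one] at h2
    rw [h2]
    refine mul_le_mul_of_nonneg_right (h1.trans (mul_le_mul_of_nonneg_right ?_ hw))
      (trigNorm_nonneg _ _)
    have : 0 ≤ 4 * s * Real.exp (2 * s) := by positivity
    linarith
  · simp only [lowerNeighbor, dif_neg h]
    have h1 := (isMult_exp_ceil_sub_one hs (hm (j.succAbove (j.castPred h))) (hj _) hx).mono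
      (mul_le_mul_of_nonneg_right (show 11 + 4 * s * Real.exp (2 * s) ≤
        11 + 4 * s * Real.exp (2 * s) + 2 * s by linarith) hw) d
      (polyhedralFinset r s (fun i => m (j.succAbove i)) fun _ => hm _) (j.castPred h)
      (fun _ => 1) fun γ hγ => by
        have hγ := mem_polyhedralFinset.1 hγ
        exact ⟨hr.trans (hγ.1 _), hγ.2.2 _⟩
    simpa only [one_mul] using h1

theorem integral_norm_trigPoly_insertNth_le (hr : 0 ≤ r) (hrs : r < s) (hm : ∀ i, 0 < m i)
    (j : Fin (d + 1)) (hj : ∀ i, m i ≤ m j) {x : ℝ} (hx : |x| ≤ Real.pi) (hx0 : x ≠ 0) :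
    ∫ t, ‖trigPoly (polyhedralFinset r s m hm) (fun _ => 1) (Fin.insertNth j x t)‖ ∂boxMeasure d ≤
      Real.pi * (11 + 4 * s * Real.exp (2 * s) + 2 * s) *
        trigNorm (polyhedralFinset r s (fun i => m (j.succAbove i)) fun _ => hm _) (fun _ => 1) *
        kernelWeight (m j) x := by
  set I := ∫ t, ‖trigPoly (polyhedralFinset r s m hm) (fun _ => 1)
    (Fin.insertNth j x t)‖ ∂boxMeasure d
  have hI : 0 ≤ I := integral_nonneg fun _ => norm_nonneg _
  have hpi := Real.pi_pos
  have hx1 : 0 < |x| := abs_pos.2 hx0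
  have h0 : ‖Complex.exp (Complex.I * (x : ℂ)) - 1‖ * I =
      ∫ t, ‖(Complex.exp (Complex.I * (x : ℂ)) - 1) * trigPoly (polyhedralFinset r s m hm)
        (fun _ => 1) (Fin.insertNth j x t)‖ ∂boxMeasure d := by
    simp only [norm_mul]
    rw [integral_const_mul]
  simp only [exp_sub_one_mul_trigPoly hrs.le hm j x] at h0
  have h1 := h0.le.trans (trigNorm_add_le _ _ _)
  rw [trigNorm_smul, norm_neg, norm_one, one_mul] at h1
  have h2 := trigNorm_upper_le hr hrs hm j hj hx
  have h3 := trigNorm_lower_le hr hrs hm j hj hx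
  have h4 := mul_le_mul_of_nonneg_right (two_div_pi_mul_abs_le_norm_exp_sub_one hx) hI
  set T := trigNorm (polyhedralFinset r s (fun i => m (j.succAbove i)) fun _ => hm _) fun _ => 1
  have h5 : 2 / Real.pi * |x| * I ≤ 2 / Real.pi * |x| * (Real.pi *
      (11 + 4 * s * Real.exp (2 * s) + 2 * s) * T * kernelWeight (m j) x) := by
    refine (h4.trans (h1.trans (add_le_add h2 h3))).trans (le_of_eq ?_)
    field_simp
    ring
  exact le_of_mul_le_mul_left h5 (by positivity)

theorem lebesgueConstant_polyhedralFinset_succ_le (hr : 0 ≤ r) (hrs : r < s)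
    (hm : ∀ i, 0 < m i) (j : Fin (d + 1)) (hj : ∀ i, m i ≤ m j) :
    lebesgueConstant (polyhedralFinset r s m hm) ≤
      (Real.pi + 3) * (11 + 4 * s * Real.exp (2 * s) + 2 * s) * Real.log (m j + 1) *
        lebesgueConstant (polyhedralFinset r s (fun i => m (j.succAbove i)) fun _ => hm _) := by
  have hpi := Real.pi_pos
  have hs : 0 < s := hr.trans_lt hrs
  have hp : (1 : ℝ) ≤ m j := by exact_mod_cast hm j
  rw [lebesgueConstant_eq, lebesgueConstant_eq]
  set T := trigNorm (polyhedralFinset r s (fun i => m (j.succAbove i)) fun _ => hm _) fun _ => 1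
    with hT
  have hT0 : 0 ≤ T := trigNorm_nonneg _ _
  set K := 11 + 4 * s * Real.exp (2 * s) + 2 * s
  have hK : 0 ≤ K := by positivity
  have key : trigNorm (polyhedralFinset r s m hm) (fun _ => 1) ≤
      Real.pi * K * T * ((2 * Real.pi + 6) * Real.log (m j + 1)) := by
    have hsplit := integral_boxMeasure_succ j
      (integrable_norm_trigPoly (polyhedralFinset r s m hm) fun _ => 1)
    rw [trigNorm, hsplit.1]
    refine le_trans (integral_mono_ae hsplit.2.1
      ((integrable_kernelWeight (zero_le_one.trans hp)).const_mul (Real.pi * K * T)) ?_) ?_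
    -- The point `x = 0`, where division by `e^{ix} - 1` fails, is a null set.
    · have h0 : ∀ᵐ x ∂circleMeasure, x ≠ 0 := ae_restrict_of_ae (Measure.ae_ne volume 0)
      filter_upwards [h0, ae_restrict_mem measurableSet_Ico] with x hx0 hx
      exact integral_norm_trigPoly_insertNth_le hr hrs hm j hj
        (abs_le.2 ⟨hx.1, hx.2.le⟩) hx0
    · rw [integral_const_mul]
      exact mul_le_mul_of_nonneg_left (integral_kernelWeight_le hp) (by positivity)
  calc _ ≤ 1 / (2 * Real.pi) ^ (d + 1) *
        (Real.pi * K * T * ((2 * Real.pi + 6) * Real.log (m j + 1))) := by gcongr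
    _ = _ := by
      field_simp
      ring

end Elimination

/-! ### Induction on the dimension. -/

theorem lebesgueConstant_fin_zero_le (Γ : Finset (Fin 0 → ℤ)) : lebesgueConstant Γ ≤ 1 := by
  have hΓ : Γ.card ≤ 1 := Finset.card_le_one_of_subsingleton Γ
  have h := trigNorm_le Γ fun _ => 1
  rw [lebesgueConstant_eq]
  have hb : (boxMeasure 0).real univ = 1 := by
    simp [boxMeasure, measureReal_def]
  have : (Γ.card : ℝ) ≤ 1 := by exact_mod_cast hΓ
  simp [hb] at h ⊢
  linarith

theorem lebesgueConstant_polyhedralFinset_le {r s : ℝ} (hr : 0 ≤ r) (hrs : r < s) (d : ℕ)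
    (m : Fin d → ℕ) (hm : ∀ i, 0 < m i) :
    lebesgueConstant (polyhedralFinset r s m hm) ≤
      ((Real.pi + 3) * (11 + 4 * s * Real.exp (2 * s) + 2 * s)) ^ d *
        ∏ i, Real.log ((m i : ℝ) + 1) := by
  have hs : 0 < s := hr.trans_lt hrs
  induction d with
  | zero => simpa using lebesgueConstant_fin_zero_le _
  | succ d ih =>
    -- Deleting any coordinate leaves a set of the same kind, so `j` may be chosen to maximize `m
    -- j`.
    obtain ⟨j, hj⟩ := Finite.exists_max m
    refine (lebesgueConstant_polyhedralFinset_succ_le hr hrs hm j hj).trans ?_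
    have hlog : 0 ≤ Real.log ((m j : ℝ) + 1) := Real.log_nonneg (by simp)
    have hpi := Real.pi_pos
    refine (mul_le_mul_of_nonneg_left (ih (fun i => m (j.succAbove i)) fun _ => hm _)
      (by positivity)).trans (le_of_eq ?_)
    rw [Fin.prod_univ_succAbove _ j]
    ring

theorem theoremA1511231653 (d : ℕ) (hd : 1 ≤ d) (r s : ℝ) (hr : 0 ≤ r) (hrs : r < s) :
    ∃ C : ℝ, 0 < C ∧ ∀ (m : Fin d → ℕ) (hm : ∀ i, 0 < m i),
      lebesgueConstant (polyhedralFinset r s m hm) ≤ C * ∏ i, Real.log ((m i : ℝ) + 1) := by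
  have hs : 0 < s := hr.trans_lt hrs
  have hpi := Real.pi_pos
  exact ⟨_, by positivity, lebesgueConstant_polyhedralFinset_le hr hrs d⟩
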